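/- Let $\Phi$ be a countable set of atoms, $I$ a finite set of agents, $\mathcal L$ the modal language $\varphi ::= \top \mid p \mid \neg\varphi \mid \varphi\wedge\varphi \mid \square_i\varphi$ ($p\in\Phi$, $i\in I$), and let $\Lambda$ be a logic over $\mathcal L$, i.e. a set of formulas containing the theorems of the minimal normal modal logic $K$ and closed under modus ponens. A set $A$ of formulas $\Lambda$-entails $\varphi$ if $\Lambda$ proves $\bigwedge A_0\to\varphi$ for some finite $A_0\subseteq A$; $A$ is $\Lambda$-consistent if it does not $\Lambda$-entail $\bot$; $\Lambda$ is compact if a set of formulas is $\Lambda$-consistent iff all its finite subsets are. A $\Lambda$-proposition is a class $\boldsymbol\varphi$ of $\Lambda$-provably equivalent formulas; $\boldsymbol{\mathcal L}_\Lambda$ is the set of all of them. Let $X$ be a set of pointed Kripke models (with countably many states) at which all theorems of $\Lambda$ hold, and let $\boldsymbol X$ be its modal space, the quotient of $X$ by satisfying the same formulas. Assume that $\Lambda$ is compact and that $\boldsymbol X$ is saturated: every $\Lambda$-consistent set of formulas is satisfied at some point of $\boldsymbol X$. Let $d\in\mathcal D_{\boldsymbol X}$, that is, $d(\boldsymbol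 x,\boldsymbol y)=\sum_{\boldsymbol\varphi\in D} w(\boldsymbol\varphi)\,d_{\boldsymbol\varphi}(\boldsymbol x,\boldsymbol y)$, where $d_{\boldsymbol\varphi}(\boldsymbol x,\boldsymbol y)$ is $0$ if $\boldsymbol x,\boldsymbol y$ agree on $\boldsymbol\varphi$ and $1$ otherwise, $w:D\to\mathbb R_{>0}$ is summable, and $D\subseteq\boldsymbol{\mathcal L}_\Lambda$ is such that for every formula $\psi$ there is $B\subseteq D$ for which every set obtained by choosing, for each member of $B$, either it or its negation $\Lambda$-entails $\psi$ or $\neg\psi$. Write $\boldsymbol X_d$ for $\boldsymbol X$ with the metric $d$. A multi-pointed action model consists of a countable set of actions, accessibility relations $\mathsf R_i$ on it for $i\in I$, a precondition $pre(\sigma)\in\mathcal L$ and a postcondition $post(\sigma)$ ($\top$ or a conjunction of literals) for each action $\sigma$, and a non-empty set $\Gamma$ of designated actions. It is exhaustive over $X$ if every $x\in X$ satisfies $pre(\sigma)$ for some $\sigma\in\Gamma$, and deterministic over $X$ if no $x\in X$ satisfies $pre(\sigma)\wedge pre(\sigma')$ for distinct $\sigma,\sigma'\in\Gamma$. The product update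 $x\otimes\Sigma_\Gamma$ of $x=(M,s)$ has as states the pairs $(t,\tau)$ with $(M,t)\vDash pre(\tau)$; $(t,\tau)$ is $i$-related to $(t',\tau')$ iff $t R_i t'$ and $\tau\mathsf R_i\tau'$; $p$ is true at $(t,\tau)$ iff $post(\tau)\vDash p$, or $p$ is true at $t$ and $post(\tau)\nvDash\neg p$; and its point is $(s,\sigma)$ for the unique $\sigma\in\Gamma$ with $x\vDash pre(\sigma)$. The action model is closing over $X$ if $x\otimes\Sigma_\Gamma\in X$ for all $x\in X$, and precondition finite if its preconditions represent only finitely many $\Lambda$-propositions. A map $\boldsymbol f:\boldsymbol X\to\boldsymbol X$ is clean, based on $\Sigma_\Gamma$, if $\Sigma_\Gamma$ is precondition finite and closing, deterministic and exhaustive over $X$, and $\boldsymbol f$ sends the class of each $x\in X$ to the class of $x\otimes\Sigma_\Gamma$. **Proposition.** Let $\boldsymbol f:\boldsymbol X\to\boldsymbol X$ be a clean map based on an action model that is finite (finitely many actions), Boolean (every precondition is free of modal operators) and static (every postcondition is $\top$). Then for every $\boldsymbol x\in\boldsymbol X$ the orbit of $\boldsymbol x$ is, in the limit, periodic with period $1$: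 there is a point $\boldsymbol y\in\boldsymbol X$ with $\boldsymbol f(\boldsymbol y)=\boldsymbol y$ such that $\boldsymbol f^n(\boldsymbol x)\to\boldsymbol y$ in $\boldsymbol X_d$ as $n\to\infty$, and the limit set of $\boldsymbol x$ under $\boldsymbol f$ (the set of limits in $\boldsymbol X_d$ of subsequences $\boldsymbol f^{n_1}(\boldsymbol x),\boldsymbol f^{n_2}(\boldsymbol x),\dots$ with $n_1<n_2<\cdots$) is $\{\boldsymbol y\}$. -/

import Mathlib

universe a b u

namespace DEL

/-- The modal language over atoms `Φ` and agents `I`. -/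
inductive Formula (Φ I : Type*) where
  | top : Formula Φ I
  | atom : Φ → Formula Φ I
  | neg : Formula Φ I → Formula Φ I
  | and : Formula Φ I → Formula Φ I → Formula Φ I
  | box : I → Formula Φ I → Formula Φ I

namespace Formula

variable {Φ I : Type*}

def bot : Formula Φ I := neg top

def imp (φ ψ : Formula Φ I) : Formula Φ I := neg (and φ (neg ψ))

def iff (φ ψ : Formula Φ I) : Formula Φ I := and (imp φ ψ) (imp ψ φ)

/-- Conjunction of a finite list of formulas (the empty conjunction is `⊤`). -/
def conj : List (Formula Φ I) → Formula Φ I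
  | [] => top
  | φ :: L => and φ (conj L)

/-- Boolean formulas: those without modal operators. -/
def IsBoolean : Formula Φ I → Prop
  | top => True
  | atom _ => True
  | neg φ => φ.IsBoolean
  | and φ ψ => φ.IsBoolean ∧ ψ.IsBoolean
  | box _ _ => False

/-- Conjunctive clauses: conjunctions of literals. -/
inductive IsClause : Formula Φ I → Prop
  | pos (p : Φ) : IsClause (atom p)
  | neg (p : Φ) : IsClause (neg (atom p))
  | and {φ ψ : Formula Φ I} : IsClause φ → IsClause ψ → IsClause (and φ ψ)

/-- Truth-functional evaluation, where atoms and boxed formulas are treated as propositional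
letters whose truth values are given by `v`. -/
def PropEval (v : Formula Φ I → Prop) : Formula Φ I → Prop
  | top => True
  | atom p => v (atom p)
  | neg φ => ¬ φ.PropEval v
  | and φ ψ => φ.PropEval v ∧ ψ.PropEval v
  | box i φ => v (box i φ)

/-- Substitution instances of propositional tautologies. -/
def IsTautology (φ : Formula Φ I) : Prop := ∀ v, φ.PropEval v

end Formula

/-- Theorems of the minimal normal modal logic `K`. -/
inductive KTheorem {Φ I : Type*} : Formula Φ I → Prop
  | taut {φ : Formula Φ I} : φ.IsTautology → KTheorem φ
  | axK (i : I) (φ ψ : Formula Φ I) :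
      KTheorem (.imp (.box i (.imp φ ψ)) (.imp (.box i φ) (.box i ψ)))
  | mp {φ ψ : Formula Φ I} : KTheorem (.imp φ ψ) → KTheorem φ → KTheorem ψ
  | nec (i : I) {φ : Formula Φ I} : KTheorem φ → KTheorem (.box i φ)

/-- A logic: a set of formulas (the theorems) that extends `K` and is closed under modus ponens.
Every normal modal logic is one. -/
structure Logic (Φ I : Type*) where
  thms : Set (Formula Φ I)
  extendsK : ∀ φ, KTheorem φ → φ ∈ thms
  mp : ∀ φ ψ, Formula.imp φ ψ ∈ thms → φ ∈ thms → ψ ∈ thms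

namespace Logic

variable {Φ I : Type*}

/-- Provable equivalence. -/
def setoid (Λ : Logic Φ I) : Setoid (Formula Φ I) where
  r φ ψ := Formula.iff φ ψ ∈ Λ.thms
  iseqv := by
    refine ⟨fun φ => ?_, fun {φ ψ} h => ?_, fun {φ ψ χ} h₁ h₂ => ?_⟩
    · refine Λ.extendsK _ (.taut fun v => ?_)
      simp [Formula.iff, Formula.imp, Formula.PropEval]
    · refine Λ.mp _ _ (Λ.extendsK _ (.taut fun v => ?_)) h
      simp only [Formula.iff, Formula.imp, Formula.PropEval]
      tauto
    · refine Λ.mp _ _ (Λ.mp _ _ (Λ.extendsK _ (.taut fun v => ?_)) h₁) h₂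
      simp only [Formula.iff, Formula.imp, Formula.PropEval]
      tauto

/-- `Λ`-propositions: formulas modulo `Λ`-provable equivalence. -/
def Proposition (Λ : Logic Φ I) : Type _ := Quotient Λ.setoid

/-- The `Λ`-proposition of a formula. -/
def toProp (Λ : Logic Φ I) (φ : Formula Φ I) : Λ.Proposition := Quotient.mk Λ.setoid φ

/-- `A` `Λ`-entails `φ`: some finite conjunction of members of `A` provably implies `φ`. -/
def Entails (Λ : Logic Φ I) (A : Set (Formula Φ I)) (φ : Formula Φ I) : Prop :=
  ∃ L : List (Formula Φ I), (∀ χ ∈ L, χ ∈ A) ∧ Formula.imp (Formula.conj L) φ ∈ Λ.thms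

def Consistent (Λ : Logic Φ I) (A : Set (Formula Φ I)) : Prop := ¬ Λ.Entails A Formula.bot

/-- Logical compactness. -/
def IsCompact (Λ : Logic Φ I) : Prop :=
  ∀ A : Set (Formula Φ I), Λ.Consistent A ↔ ∀ B ⊆ A, B.Finite → Λ.Consistent B

end Logic

/-- Kripke models with a countable set of states. -/
structure KripkeModel (Φ I : Type*) where
  State : Type*
  countable : Countable State
  nonempty : Nonempty State
  rel : I → State → State → Prop
  val : Φ → Set State

/-- Satisfaction at a state. -/
def KripkeModel.Sat {Φ I : Type*} (M : KripkeModel Φ I) : M.State → Formula Φ I → Prop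
  | _, .top => True
  | s, .atom p => s ∈ M.val p
  | s, .neg φ => ¬ M.Sat s φ
  | s, .and φ ψ => M.Sat s φ ∧ M.Sat s ψ
  | s, .box i φ => ∀ t, M.rel i s t → M.Sat t φ

structure PointedModel (Φ I : Type*) extends KripkeModel Φ I where
  point : State

def PointedModel.Sat {Φ I : Type*} (x : PointedModel Φ I) (φ : Formula Φ I) : Prop :=
  x.toKripkeModel.Sat x.point φ

/-- Semantic consequence between formulas over all countable pointed Kripke models. (Every such
model has an isomorphic copy whose states form a type in the lowest universe.) -/
def Formula.Entails {Φ I : Type*} (φ ψ : Formula Φ I) : Prop :=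
  ∀ x : PointedModel.{_, _, 0} Φ I, x.Sat φ → x.Sat ψ

/-- Every theorem of `Λ` holds at every member of `X`, i.e. truth of `Λ`-propositions at members
of `X` does not depend on the choice of a representing formula. -/
def Logic.SoundFor {Φ I : Type*} (Λ : Logic Φ I) (X : Set (PointedModel Φ I)) : Prop :=
  ∀ x ∈ X, ∀ φ ∈ Λ.thms, x.Sat φ

/-- Modal equivalence on a set of pointed Kripke models. -/
def modalEquiv {Φ I : Type*} (X : Set (PointedModel Φ I)) : Setoid X where
  r x y := ∀ φ, x.1.Sat φ ↔ y.1.Sat φ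
  iseqv := ⟨fun _ _ => Iff.rfl, fun h φ => (h φ).symm, fun h₁ h₂ φ => (h₁ φ).trans (h₂ φ)⟩

/-- The modal space of a set of pointed Kripke models. -/
def ModalSpace {Φ I : Type*} (X : Set (PointedModel Φ I)) : Type _ := Quotient (modalEquiv X)

namespace ModalSpace

variable {Φ I : Type*} {X : Set (PointedModel Φ I)}

/-- The point of the modal space represented by `x`. -/
def mk (x : PointedModel Φ I) (hx : x ∈ X) : ModalSpace X := Quotient.mk (modalEquiv X) ⟨x, hx⟩

/-- Truth of a formula at a point of a modal space. -/
def Sat (x : ModalSpace X) (φ : Formula Φ I) : Prop :=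
  Quotient.lift (s := modalEquiv X) (fun y : X => y.1.Sat φ) (fun _ _ h => propext (h φ)) x

end ModalSpace

/-- The modal space of `X` is saturated: every `Λ`-consistent set of formulas is satisfied at some
point. -/
def IsSaturated {Φ I : Type*} (Λ : Logic Φ I) (X : Set (PointedModel Φ I)) : Prop :=
  ∀ A : Set (Formula Φ I), Λ.Consistent A → ∃ x : ModalSpace X, ∀ φ ∈ A, x.Sat φ

/-- For a set `B` of `Λ`-propositions, the formulas representing members of `B ∩ P` together with
the negations of the formulas representing members of `B \ P`. -/
def signed {Φ I : Type*} (Λ : Logic Φ I) (B P : Set Λ.Proposition) : Set (Formula Φ I) :=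
  {χ | ∃ φ, Λ.toProp φ ∈ B ∧
    ((Λ.toProp φ ∈ P ∧ χ = φ) ∨ (Λ.toProp φ ∉ P ∧ χ = Formula.neg φ))}

/-- `D` is representative: every formula is decided by some subset `B` of `D`, i.e. however one
chooses, for each member of `B`, either it or its negation, the chosen set `Λ`-entails the formula
or its negation. -/
def IsRepresentative {Φ I : Type*} (Λ : Logic Φ I) (D : Set Λ.Proposition) : Prop :=
  ∀ ψ : Formula Φ I, ∃ B ⊆ D, ∀ P : Set Λ.Proposition,
    Λ.Entails (signed Λ B P) ψ ∨ Λ.Entails (signed Λ B P) (Formula.neg ψ)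

open Classical in
/-- `0` if `x` and `y` agree on the proposition `k`, and `1` otherwise. -/
noncomputable def disagreement {Φ I : Type*} (Λ : Logic Φ I) {X : Set (PointedModel Φ I)}
    (k : Λ.Proposition) (x y : ModalSpace X) : ℝ :=
  if ∀ φ, Λ.toProp φ = k → (x.Sat φ ↔ y.Sat φ) then 0 else 1

/-- The family of metrics on the modal space of `X`: the weighted sums of disagreements over a
representative set `D` of propositions, with positive summable weights. -/
def modalMetrics {Φ I : Type*} (Λ : Logic Φ I) (X : Set (PointedModel Φ I)) :
    Set (ModalSpace X → ModalSpace X → ℝ) :=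
  {d | ∃ (D : Set Λ.Proposition) (w : D → ℝ), IsRepresentative Λ D ∧ (∀ k, 0 < w k) ∧
    Summable w ∧ ∀ x y, d x y = ∑' k : D, w k * disagreement Λ k.1 x y}

/-- Multi-pointed action models with postconditions. -/
structure ActionModel (Φ I : Type*) where
  Action : Type*
  countable : Countable Action
  rel : I → Action → Action → Prop
  pre : Action → Formula Φ I
  post : Action → Formula Φ I
  post_spec : ∀ σ, post σ = Formula.top ∨ (post σ).IsClause
  designated : Set Action
  designated_nonempty : designated.Nonempty

namespace ActionModel

variable {Φ : Type a} {I : Type b}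

/-- Some designated action is executable at `x`. -/
def Applicable (A : ActionModel.{a, b, u} Φ I) (x : PointedModel.{a, b, u} Φ I) : Prop :=
  ∃ σ ∈ A.designated, x.Sat (A.pre σ)

/-- The product update `x ⊗ A`. The designated action in its point is unique whenever `A` is
deterministic over a set containing `x`. -/
noncomputable def update (A : ActionModel.{a, b, u} Φ I) (x : PointedModel.{a, b, u} Φ I)
    (h : A.Applicable x) : PointedModel.{a, b, u} Φ I where
  State := {q : x.State × A.Action // x.toKripkeModel.Sat q.1 (A.pre q.2)}
  countable := by
    have := x.countable
    have := A.countable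
    infer_instance
  nonempty := ⟨⟨(x.point, h.choose), h.choose_spec.2⟩⟩
  rel i q r := x.rel i q.1.1 r.1.1 ∧ A.rel i q.1.2 r.1.2
  val p := {q | (q.1.1 ∈ x.val p ∧ ¬ (A.post q.1.2).Entails (.neg (.atom p))) ∨
    (A.post q.1.2).Entails (.atom p)}
  point := ⟨(x.point, h.choose), h.choose_spec.2⟩

def PreconditionFinite (A : ActionModel.{a, b, u} Φ I) (Λ : Logic Φ I) : Prop :=
  (Set.range fun σ => Λ.toProp (A.pre σ)).Finite

def ExhaustiveOver (A : ActionModel.{a, b, u} Φ I) (X : Set (PointedModel.{a, b, u} Φ I)) : Prop :=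
  ∀ x ∈ X, A.Applicable x

def DeterministicOver (A : ActionModel.{a, b, u} Φ I)
    (X : Set (PointedModel.{a, b, u} Φ I)) : Prop :=
  ∀ σ ∈ A.designated, ∀ σ' ∈ A.designated, σ ≠ σ' →
    ∀ x ∈ X, x.Sat (.imp (.and (A.pre σ) (A.pre σ')) .bot)

def ClosingOver (A : ActionModel.{a, b, u} Φ I) (X : Set (PointedModel.{a, b, u} Φ I)) : Prop :=
  ∀ x ∈ X, ∀ h : A.Applicable x, A.update x h ∈ X

/-- The map `f` is the clean map based on the action model `A`. -/
structure IsCleanMap (A : ActionModel.{a, b, u} Φ I) (Λ : Logic Φ I)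
    (X : Set (PointedModel.{a, b, u} Φ I)) (f : ModalSpace X → ModalSpace X) : Prop where
  preconditionFinite : A.PreconditionFinite Λ
  exhaustive : A.ExhaustiveOver X
  deterministic : A.DeterministicOver X
  closing : A.ClosingOver X
  map_mk : ∀ (x : PointedModel.{a, b, u} Φ I) (hx : x ∈ X),
    f (ModalSpace.mk x hx) =
      ModalSpace.mk (A.update x (exhaustive x hx)) (closing x hx (exhaustive x hx))

def IsFinite (A : ActionModel.{a, b, u} Φ I) : Prop := Finite A.Action

def IsBoolean (A : ActionModel.{a, b, u} Φ I) : Prop := ∀ σ, (A.pre σ).IsBoolean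

def IsStatic (A : ActionModel.{a, b, u} Φ I) : Prop := ∀ σ, A.post σ = Formula.top

end ActionModel

/-- Convergence of a sequence to `y` with respect to the distance function `d`. -/
def ConvergesTo {S : Type*} (d : S → S → ℝ) (s : ℕ → S) (y : S) : Prop :=
  Filter.Tendsto (fun n => d (s n) y) Filter.atTop (nhds 0)

/-- The limit set of `x` under `f` with respect to `d`. -/
def limitSet {S : Type*} (d : S → S → ℝ) (f : S → S) (x : S) : Set S :=
  {y | ∃ n : ℕ → ℕ, StrictMono n ∧ ConvergesTo d (fun k => f^[n k] x) y}

end DEL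

/-! A static update leaves valuations unchanged, so Boolean preconditions can be evaluated in the
initial model `M` throughout. The `n`-fold update is therefore a product of `M` with `n`
interchangeable copies of the action model, and a state may be recorded as a state of `M` with a
multiset of actions (`IsMultiProj`). Determinism makes every step use the same designated action
`σ`, so the `n`-th point carries `n` copies of `σ`.

A fixed formula cannot count high multiplicities: by pigeonhole over the finitely many actions, one
more copy of an already frequent action does not change its truth value
(`exists_multiSat_cons_iff`). Every formula thus stabilises along the orbit, and saturation realises
the limiting theory at a point `y`. This `y` is the limit in `d`, and it is fixed because truth
after a finite static update is expressible before it (`exists_sat_map_iff`). Limits are unique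
because representative sets separate points. -/

namespace DEL

open Filter Topology

/-! ### Satisfaction, soundness and limits of theories -/

namespace KripkeModel

variable {Φ I : Type*} {M : KripkeModel Φ I} {s : M.State}

@[simp] theorem sat_top : M.Sat s .top ↔ True := by simp [Sat]

@[simp] theorem sat_atom {p : Φ} : M.Sat s (.atom p) ↔ s ∈ M.val p := by simp [Sat]

@[simp] theorem sat_neg {φ : Formula Φ I} : M.Sat s (.neg φ) ↔ ¬ M.Sat s φ := by simp [Sat]

@[simp] theorem sat_and {φ ψ : Formula Φ I} :
    M.Sat s (.and φ ψ) ↔ M.Sat s φ ∧ M.Sat s ψ := by simp [Sat]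

@[simp] theorem sat_box {i : I} {φ : Formula Φ I} :
    M.Sat s (.box i φ) ↔ ∀ t, M.rel i s t → M.Sat t φ := by simp [Sat]

@[simp] theorem sat_bot : M.Sat s .bot ↔ False := by simp [Formula.bot]

@[simp] theorem sat_imp {φ ψ : Formula Φ I} :
    M.Sat s (.imp φ ψ) ↔ (M.Sat s φ → M.Sat s ψ) := by simp [Formula.imp]

@[simp] theorem sat_iff {φ ψ : Formula Φ I} :
    M.Sat s (.iff φ ψ) ↔ (M.Sat s φ ↔ M.Sat s ψ) := by
  simp [Formula.iff, iff_iff_implies_and_implies]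

theorem sat_conj {L : List (Formula Φ I)} : M.Sat s (.conj L) ↔ ∀ χ ∈ L, M.Sat s χ := by
  induction L with
  | nil => simp [Formula.conj]
  | cons φ L ih => simp [Formula.conj, ih]

end KripkeModel

/-- The conjunction of a finite family of formulas. -/
noncomputable def Formula.bigAnd {Φ I ι : Type*} [Finite ι] (g : ι → Formula Φ I) : Formula Φ I :=
  .conj ((Set.finite_range g).toFinset.toList)

theorem KripkeModel.sat_bigAnd {Φ I ι : Type*} [Finite ι] {M : KripkeModel Φ I} {s : M.State}
    {g : ι → Formula Φ I} : M.Sat s (.bigAnd g) ↔ ∀ j, M.Sat s (g j) := by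
  simp [Formula.bigAnd, sat_conj]

namespace ModalSpace

variable {Φ I : Type*} {X : Set (PointedModel Φ I)}

theorem exists_mk (x : ModalSpace X) : ∃ y hy, x = mk y hy := by
  induction x using Quotient.inductionOn with
  | h y => exact ⟨y.1, y.2, rfl⟩

theorem sat_mk {y : PointedModel Φ I} {hy : y ∈ X} {φ : Formula Φ I} :
    (mk y hy).Sat φ ↔ y.toKripkeModel.Sat y.point φ := Iff.rfl

theorem ext_sat {x y : ModalSpace X} (h : ∀ φ, x.Sat φ ↔ y.Sat φ) : x = y := by
  obtain ⟨x, hx, rfl⟩ := x.exists_mk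
  obtain ⟨y, hy, rfl⟩ := y.exists_mk
  exact Quotient.sound (s := modalEquiv X) h

@[simp] theorem sat_neg {x : ModalSpace X} {φ : Formula Φ I} : x.Sat (.neg φ) ↔ ¬ x.Sat φ := by
  obtain ⟨x, hx, rfl⟩ := x.exists_mk
  simp [sat_mk]

theorem sat_of_entails {Λ : Logic Φ I} (hX : Λ.SoundFor X) {S : Set (Formula Φ I)}
    {φ : Formula Φ I} (h : Λ.Entails S φ) {x : ModalSpace X} (hx : ∀ χ ∈ S, x.Sat χ) :
    x.Sat φ := by
  obtain ⟨x, hxX, rfl⟩ := x.exists_mk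
  obtain ⟨L, hL, hφ⟩ := h
  exact KripkeModel.sat_imp.1 (hX x hxX _ hφ) (KripkeModel.sat_conj.2 fun χ hχ => hx χ (hL χ hχ))

theorem sat_congr {Λ : Logic Φ I} (hX : Λ.SoundFor X) {φ ψ : Formula Φ I}
    (h : Λ.toProp φ = Λ.toProp ψ) (x : ModalSpace X) : x.Sat φ ↔ x.Sat ψ := by
  obtain ⟨x, hxX, rfl⟩ := x.exists_mk
  exact KripkeModel.sat_iff.1 (hX x hxX _ (Quotient.exact (s := Λ.setoid) h))

/-- If the truth value of every formula is eventually constant along a sequence in a saturated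
modal space, then these truth values are those at some point of the space. -/
theorem exists_limit {Λ : Logic Φ I} (hX : Λ.SoundFor X) (hsat : IsSaturated Λ X)
    {s : ℕ → ModalSpace X} (hs : ∀ φ, ∃ N, ∀ n ≥ N, ((s n).Sat φ ↔ (s N).Sat φ)) :
    ∃ y : ModalSpace X, ∀ φ, ∀ᶠ n in atTop, ((s n).Sat φ ↔ y.Sat φ) := by
  -- Finitely many eventually true formulas hold together at some `s n`, where soundness rules out a
  -- contradiction.
  have hcons : Λ.Consistent {φ | ∀ᶠ n in atTop, (s n).Sat φ} := by
    rintro ⟨L, hL, hbot⟩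
    have hev : ∀ᶠ n in atTop, ∀ χ ∈ {χ | χ ∈ L}, (s n).Sat χ :=
      (eventually_all_finite L.finite_toSet).2 hL
    obtain ⟨n, hn⟩ := hev.exists
    obtain ⟨x, hxX, hx⟩ := (s n).exists_mk
    have h : (s n).Sat .bot := sat_of_entails hX ⟨L, fun _ h => h, hbot⟩ hn
    rw [hx, sat_mk] at h
    exact KripkeModel.sat_bot.1 h
  obtain ⟨y, hy⟩ := hsat _ hcons
  refine ⟨y, fun φ => ?_⟩
  obtain ⟨N, hN⟩ := hs φ
  by_cases h : (s N).Sat φ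
  · have hφ : ∀ᶠ n in atTop, (s n).Sat φ :=
      (eventually_ge_atTop N).mono fun n hn => (hN n hn).2 h
    exact hφ.mono fun n hn => iff_of_true hn (hy φ hφ)
  · have hφ : ∀ᶠ n in atTop, (s n).Sat (.neg φ) :=
      (eventually_ge_atTop N).mono fun n hn => sat_neg.2 (mt (hN n hn).1 h)
    exact hφ.mono fun n hn => iff_of_false (sat_neg.1 hn) (sat_neg.1 (hy _ hφ))

end ModalSpace

/-! ### Convergence and uniqueness of limits for the metrics -/

section Metric

variable {Φ I : Type*} {Λ : Logic Φ I} {X : Set (PointedModel Φ I)}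

theorem disagreement_nonneg (k : Λ.Proposition) (x y : ModalSpace X) :
    0 ≤ disagreement Λ k x y := by
  unfold disagreement; split_ifs <;> norm_num

theorem disagreement_le_one (k : Λ.Proposition) (x y : ModalSpace X) :
    disagreement Λ k x y ≤ 1 := by
  unfold disagreement; split_ifs <;> norm_num

theorem disagreement_toProp (hX : Λ.SoundFor X) {φ : Formula Φ I} {x y : ModalSpace X}
    (h : x.Sat φ ↔ y.Sat φ) : disagreement Λ (Λ.toProp φ) x y = 0 :=
  if_pos fun _ hψ => (ModalSpace.sat_congr hX hψ x).trans <|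
    h.trans (ModalSpace.sat_congr hX hψ y).symm

theorem sat_iff_of_disagreement_lt_one {φ : Formula Φ I} {x y : ModalSpace X}
    (h : disagreement Λ (Λ.toProp φ) x y < 1) : x.Sat φ ↔ y.Sat φ := by
  unfold disagreement at h
  split_ifs at h with h'
  · exact h' φ rfl
  · exact absurd h (lt_irrefl _)

/-- Each term of the series is eventually zero, and the summable weights dominate, so the limit
passes through the sum. -/
theorem convergesTo_of_eventually_sat (hX : Λ.SoundFor X)
    {d : ModalSpace X → ModalSpace X → ℝ} (hd : d ∈ modalMetrics Λ X)
    {s : ℕ → ModalSpace X} {y : ModalSpace X}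
    (h : ∀ φ, ∀ᶠ n in atTop, ((s n).Sat φ ↔ y.Sat φ)) : ConvergesTo d s y := by
  obtain ⟨D, w, -, hw, hsum, hd⟩ := hd
  have key : Tendsto (fun n => ∑' k : D, w k * disagreement Λ k.1 (s n) y) atTop
      (𝓝 (∑' _ : D, (0 : ℝ))) := by
    refine tendsto_tsum_of_dominated_convergence hsum (fun k => ?_) (Eventually.of_forall ?_)
    · obtain ⟨φ, hφ⟩ := Quotient.exists_rep (s := Λ.setoid) k.1
      refine tendsto_const_nhds.congr' ((h φ).mono fun n hn => ?_)
      have := disagreement_toProp hX hn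
      rw [← hφ]
      exact (mul_eq_zero_of_right _ this).symm
    · intro n k
      rw [Real.norm_eq_abs, abs_of_nonneg (mul_nonneg (hw k).le (disagreement_nonneg _ _ _))]
      exact mul_le_of_le_one_right (hw k).le (disagreement_le_one _ _ _)
  simpa only [ConvergesTo, hd, tsum_zero] using key

/-- Limits in a modal space are unique: a convergent sequence eventually agrees with its limit on
every proposition of a representative set, and such a set separates points. -/
theorem eq_of_convergesTo (hX : Λ.SoundFor X)
    {d : ModalSpace X → ModalSpace X → ℝ} (hd : d ∈ modalMetrics Λ X)
    {s : ℕ → ModalSpace X} {y z : ModalSpace X}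
    (hy : ConvergesTo d s y) (hz : ConvergesTo d s z) : z = y := by
  obtain ⟨D, w, hrep, hw, hsum, hd⟩ := hd
  have hev : ∀ {y}, ConvergesTo d s y → ∀ φ, Λ.toProp φ ∈ D →
      ∀ᶠ n in atTop, ((s n).Sat φ ↔ y.Sat φ) := by
    intro y hy φ hφ
    -- Once the distance is below the weight of `φ`, the single term for `φ` is too, which forces
    -- agreement on `φ`.
    filter_upwards [hy.eventually_lt_const (hw ⟨_, hφ⟩)] with n hn
    refine sat_iff_of_disagreement_lt_one (Λ := Λ) ?_
    have hle : ∀ k : D, w k * disagreement Λ k.1 (s n) y ≤ w k := fun k =>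
      mul_le_of_le_one_right (hw k).le (disagreement_le_one _ _ _)
    have hnn : ∀ k : D, 0 ≤ w k * disagreement Λ k.1 (s n) y := fun k =>
      mul_nonneg (hw k).le (disagreement_nonneg _ _ _)
    have h1 := (hsum.of_nonneg_of_le hnn hle).le_tsum ⟨_, hφ⟩ fun k _ => hnn k
    rw [hd] at hn
    exact (mul_lt_iff_lt_one_right (hw ⟨_, hφ⟩)).1 (h1.trans_lt hn)
  have hag : ∀ φ, Λ.toProp φ ∈ D → (z.Sat φ ↔ y.Sat φ) := fun φ hφ => by
    obtain ⟨n, h₁, h₂⟩ := ((hev hz φ hφ).and (hev hy φ hφ)).exists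
    exact h₁.symm.trans h₂
  refine ModalSpace.ext_sat fun ψ => ?_
  obtain ⟨B, hB, hdec⟩ := hrep ψ
  -- The choice of signs made by `y`; since `z` agrees with `y` on `D`, both satisfy the signed set,
  -- which decides `ψ`.
  let P : Set Λ.Proposition := {k | ∃ φ, Λ.toProp φ = k ∧ y.Sat φ}
  have hyP : ∀ χ ∈ signed Λ B P, y.Sat χ := by
    rintro χ ⟨φ, -, ⟨⟨φ', hφ', hy'⟩, rfl⟩ | ⟨hn, rfl⟩⟩
    · exact (ModalSpace.sat_congr hX hφ' y).1 hy'
    · exact ModalSpace.sat_neg.2 fun hy' => hn ⟨φ, rfl, hy'⟩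
  have hzP : ∀ χ ∈ signed Λ B P, z.Sat χ := by
    intro χ hχ
    have := hyP χ hχ
    obtain ⟨φ, hφ, ⟨-, rfl⟩ | ⟨-, rfl⟩⟩ := hχ
    · exact (hag _ (hB hφ)).2 this
    · rw [ModalSpace.sat_neg] at this ⊢
      rwa [hag _ (hB hφ)]
  rcases hdec P with h | h
  · exact iff_of_true (ModalSpace.sat_of_entails hX h hzP) (ModalSpace.sat_of_entails hX h hyP)
  · exact iff_of_false (ModalSpace.sat_neg.1 (ModalSpace.sat_of_entails hX h hzP))
      (ModalSpace.sat_neg.1 (ModalSpace.sat_of_entails hX h hyP))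

end Metric

/-! ### Trivial postconditions and the pigeonhole for multisets -/

theorem Formula.not_top_entails_atom {Φ : Type*} {I : Type*} (p : Φ) :
    ¬ (Formula.top : Formula Φ I).Entails (.atom p) := fun h => by
  have := h ⟨⟨Unit, inferInstance, inferInstance, fun _ _ _ => True, fun _ => ∅⟩, ()⟩
  simp [PointedModel.Sat] at this

theorem Formula.not_top_entails_neg_atom {Φ : Type*} {I : Type*} (p : Φ) :
    ¬ (Formula.top : Formula Φ I).Entails (.neg (.atom p)) := fun h => by
  have := h ⟨⟨Unit, inferInstance, inferInstance, fun _ _ _ => True, fun _ => Set.univ⟩, ()⟩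
  simp [PointedModel.Sat] at this

/-- A multiset related to one with many copies of `τ` contains many copies of some successor of
`τ`, one of which can be matched with `τ`. -/
theorem _root_.Multiset.Rel.exists_successor {α : Type*} [Fintype α] [DecidableEq α]
    {r : α → α → Prop} {m v : Multiset α} (h : Multiset.Rel r m v) {τ : α} {N : ℕ}
    (hN : Fintype.card α * N + 1 ≤ m.count τ) :
    ∃ τ', r τ τ' ∧ ∃ v', v = τ' ::ₘ v' ∧ N ≤ v'.count τ' ∧ Multiset.Rel r (m.erase τ) v' := by
  obtain ⟨m', rfl⟩ := Multiset.le_iff_exists_add.1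
    (Multiset.le_count_iff_replicate_le.1 hN)
  obtain ⟨v₀, v₁, h₀, h₁, rfl⟩ := Multiset.rel_add_left.1 h
  obtain ⟨hcard, hr⟩ := Multiset.rel_replicate_left.1 h₀
  -- `v₀` collects the partners of the `card * N + 1` copies of `τ`. The strict inequality leaves
  -- `N` copies after one is removed.
  obtain ⟨τ', hτ'⟩ : ∃ τ', N < v₀.count τ' := by
    by_contra! hle
    have : v₀.card ≤ Fintype.card α * N := by
      rw [← Multiset.sum_count_eq_card (s := Finset.univ) (by simp)]
      simpa using Finset.sum_le_sum fun a (_ : a ∈ Finset.univ) => hle a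
    omega
  have hmem : τ' ∈ v₀ := Multiset.count_pos.1 (by omega)
  obtain ⟨v₀', rfl⟩ := Multiset.exists_cons_of_mem hmem
  refine ⟨τ', hr _ hmem, v₀' + v₁, by simp, ?_, ?_⟩
  · rw [Multiset.count_cons_self] at hτ'
    rw [Multiset.count_add]; omega
  -- Every member of `v₀` is a successor of `τ`, so the remaining copies of `τ` can be rematched
  -- freely.
  · rw [Multiset.replicate_succ, Multiset.cons_add, Multiset.erase_cons_head]
    refine Multiset.Rel.add (Multiset.rel_replicate_left.2 ⟨?_, fun x hx => hr x ?_⟩) h₁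
    · simpa using hcard
    · exact Multiset.mem_cons_of_mem hx

namespace ActionModel

/-! ### Iterated products as multisets of actions -/

section Multi

variable {Φ : Type a} {I : Type b} (A : ActionModel.{a, b, u} Φ I)
  (M : KripkeModel.{a, b, u} Φ I)

/-- Truth in the product of `M` with finitely many copies of `A` of which only the accessibility
relations and the preconditions (evaluated in `M`) are used; states are pairs of a state of `M`
and a multiset of actions. -/
def MultiSat : Formula Φ I → M.State → Multiset A.Action → Prop
  | .top, _, _ => True
  | .atom p, t, _ => t ∈ M.val p
  | .neg φ, t, m => ¬ MultiSat φ t m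
  | .and φ ψ, t, m => MultiSat φ t m ∧ MultiSat ψ t m
  | .box i φ, t, m => ∀ t' m', M.rel i t t' → Multiset.Rel (A.rel i) m m' →
      (∀ τ ∈ m', M.Sat t' (A.pre τ)) → MultiSat φ t' m'

open Classical in
-- The threshold depends on the formula only, not on the state, multiset or action. Passing a box
-- turns `N` into `card * N + 1`, so that some successor action still occurs often enough.
theorem exists_multiSat_cons_iff (hA : A.IsFinite) (φ : Formula Φ I) :
    ∃ N : ℕ, ∀ t m τ, N ≤ m.count τ →
      (A.MultiSat M φ t m ↔ A.MultiSat M φ t (τ ::ₘ m)) := by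
  have : Finite A.Action := hA
  have := Fintype.ofFinite A.Action
  induction φ with
  | top => exact ⟨0, fun _ _ _ _ => Iff.rfl⟩
  | atom p => exact ⟨0, fun _ _ _ _ => Iff.rfl⟩
  | neg φ ih =>
    obtain ⟨N, hN⟩ := ih
    exact ⟨N, fun t m τ h => not_congr (hN t m τ h)⟩
  | and φ ψ ih₁ ih₂ =>
    obtain ⟨N₁, h₁⟩ := ih₁
    obtain ⟨N₂, h₂⟩ := ih₂
    exact ⟨max N₁ N₂, fun t m τ h => and_congr (h₁ t m τ ((le_max_left _ _).trans h))
      (h₂ t m τ ((le_max_right _ _).trans h))⟩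
  | box i φ ih =>
    obtain ⟨N, hN⟩ := ih
    refine ⟨Fintype.card A.Action * N + 1, fun t m τ h => ⟨fun H t' v ht hv hpre => ?_,
      fun H t' v ht hv hpre => ?_⟩⟩
    -- Deleting `τ` together with a frequent successor `τ'` gives a successor of `m`; the induction
    -- hypothesis restores `τ'`.
    · obtain ⟨τ', -, v', rfl, hc, hv'⟩ := hv.exists_successor (τ := τ) (N := N)
        (by rw [Multiset.count_cons_self]; omega)
      rw [Multiset.erase_cons_head] at hv'
      exact (hN t' v' τ' hc).1 (H t' v' ht hv' fun σ hσ => hpre σ (Multiset.mem_cons_of_mem hσ))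
    -- Conversely, the extra `τ` is matched with a duplicate of a frequent `τ'`, whose precondition
    -- already holds, and the duplicate is then dropped.
    · obtain ⟨τ', hr, v', rfl, hc, -⟩ := hv.exists_successor h
      refine (hN t' _ τ' ?_).2 (H t' _ ht (.cons hr hv) fun σ hσ => hpre σ ?_)
      · rw [Multiset.count_cons_self]; omega
      · simpa using hσ

variable {A M}

/-- A bounded morphism from `M'` to the product of `M` with finite multisets of actions. -/
structure IsMultiProj (A : ActionModel.{a, b, u} Φ I) (M M' : KripkeModel.{a, b, u} Φ I)
    (π : M'.State → M.State) (ρ : M'.State → Multiset A.Action) : Prop where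
  val : ∀ q p, q ∈ M'.val p ↔ π q ∈ M.val p
  pre : ∀ q, ∀ τ ∈ ρ q, M.Sat (π q) (A.pre τ)
  forth : ∀ i q r, M'.rel i q r → M.rel i (π q) (π r) ∧ Multiset.Rel (A.rel i) (ρ q) (ρ r)
  back : ∀ i q t m, M.rel i (π q) t → Multiset.Rel (A.rel i) (ρ q) m →
    (∀ τ ∈ m, M.Sat t (A.pre τ)) → ∃ r, M'.rel i q r ∧ π r = t ∧ ρ r = m

namespace IsMultiProj

variable {M' : KripkeModel.{a, b, u} Φ I} {π : M'.State → M.State}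
  {ρ : M'.State → Multiset A.Action}

theorem sat_iff (h : IsMultiProj A M M' π ρ) (φ : Formula Φ I) (q : M'.State) :
    M'.Sat q φ ↔ A.MultiSat M φ (π q) (ρ q) := by
  induction φ generalizing q with
  | top => simp [MultiSat]
  | atom p => simp [MultiSat, h.val]
  | neg φ ih => simp [MultiSat, ih]
  | and φ ψ ih₁ ih₂ => simp [MultiSat, ih₁, ih₂]
  | box i φ ih =>
    rw [KripkeModel.sat_box]
    constructor
    · intro H t m ht hm hpre
      obtain ⟨r, hr, rfl, rfl⟩ := h.back i q t m ht hm hpre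
      exact (ih r).1 (H r hr)
    · intro H r hr
      exact (ih r).2 (H _ _ (h.forth i q r hr).1 (h.forth i q r hr).2 (h.pre r))

theorem sat_iff_of_isBoolean (h : IsMultiProj A M M' π ρ) {φ : Formula Φ I} (hφ : φ.IsBoolean)
    (q : M'.State) : M'.Sat q φ ↔ M.Sat (π q) φ := by
  induction φ with
  | top => simp
  | atom p => simp [h.val]
  | neg φ ih => simp [ih hφ]
  | and φ ψ ih₁ ih₂ => simp [ih₁ hφ.1, ih₂ hφ.2]
  | box i φ => exact hφ.elim

theorem refl : IsMultiProj A M M id (fun _ => 0) where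
  val _ _ := Iff.rfl
  pre := by simp
  forth i q r h := ⟨h, .zero⟩
  back i q t m ht hm _ := ⟨t, ht, rfl, (Multiset.rel_zero_left.1 hm).symm⟩

end IsMultiProj

theorem update_val (hA : A.IsStatic) {x : PointedModel.{a, b, u} Φ I} (h : A.Applicable x) (p : Φ)
    (q : (A.update x h).State) : q ∈ (A.update x h).val p ↔ q.1.1 ∈ x.val p := by
  change (_ ∧ _) ∨ _ ↔ _
  rw [hA]
  simp [Formula.not_top_entails_atom, Formula.not_top_entails_neg_atom]

/-- Each update adds its action to the multiset. Booleanness lets preconditions pass between the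
current model and `M`, in both directions. -/
theorem IsMultiProj.update (hbool : A.IsBoolean) (hstat : A.IsStatic)
    {x : PointedModel.{a, b, u} Φ I} {π : x.State → M.State} {ρ : x.State → Multiset A.Action}
    (h : IsMultiProj A M x.toKripkeModel π ρ) (hx : A.Applicable x) :
    IsMultiProj A M (A.update x hx).toKripkeModel (fun q => π q.1.1)
      (fun q => q.1.2 ::ₘ ρ q.1.1) where
  val q p := (update_val hstat hx p q).trans (h.val _ _)
  pre q τ hτ := by
    rcases Multiset.mem_cons.1 hτ with rfl | hτ
    · exact (h.sat_iff_of_isBoolean (hbool _) _).1 q.2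
    · exact h.pre _ _ hτ
  forth i q r hqr := ⟨(h.forth i _ _ hqr.1).1, .cons hqr.2 (h.forth i _ _ hqr.1).2⟩
  back i q t m ht hm hpre := by
    obtain ⟨τ, m', hτ, hm', rfl⟩ := Multiset.rel_cons_left.1 hm
    obtain ⟨r, hr, rfl, rfl⟩ :=
      h.back i _ t m' ht hm' fun σ hσ => hpre σ (Multiset.mem_cons_of_mem hσ)
    exact ⟨⟨(r, τ), (h.sat_iff_of_isBoolean (hbool _) _).2 (hpre τ (Multiset.mem_cons_self _ _))⟩,
      ⟨hr, hτ⟩, rfl, rfl⟩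

end Multi

/-! ### Reduction of formulas through an update -/

section Reduction

variable {Φ : Type a} {I : Type b} {A : ActionModel.{a, b, u} Φ I}

/-- The reduction of a formula: its truth after a static update at an action, expressed before. -/
noncomputable def reduction (A : ActionModel.{a, b, u} Φ I) [Finite A.Action] :
    Formula Φ I → A.Action → Formula Φ I
  | .top, _ => .top
  | .atom p, _ => .atom p
  | .neg φ, σ => .neg (reduction A φ σ)
  | .and φ ψ, σ => .and (reduction A φ σ) (reduction A ψ σ)
  | .box i φ, σ => .bigAnd fun τ : {τ // A.rel i σ τ} =>
      .box i (.imp (A.pre τ.1) (reduction A φ τ.1))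

theorem sat_reduction [Finite A.Action] (hstat : A.IsStatic)
    {x : PointedModel.{a, b, u} Φ I} (hx : A.Applicable x) (φ : Formula Φ I)
    (q : (A.update x hx).State) :
    (A.update x hx).toKripkeModel.Sat q φ ↔ x.toKripkeModel.Sat q.1.1 (A.reduction φ q.1.2) := by
  induction φ generalizing q with
  | top => simp [reduction]
  | atom p => simp [reduction, update_val hstat]
  | neg φ ih => simp [reduction, ih]
  | and φ ψ ih₁ ih₂ => simp [reduction, ih₁, ih₂]
  | box i φ ih =>
    simp only [reduction, KripkeModel.sat_bigAnd, KripkeModel.sat_box, KripkeModel.sat_imp]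
    constructor
    · intro H τ t ht hpre
      exact (ih ⟨(t, τ.1), hpre⟩).1 (H ⟨(t, τ.1), hpre⟩ ⟨ht, τ.2⟩)
    · intro H r hr
      exact (ih r).2 (H ⟨r.1.2, hr.2⟩ _ hr.1 r.2)

end Reduction

/-! ### Orbits of clean maps -/

namespace IsCleanMap

variable {Φ : Type a} {I : Type b} {A : ActionModel.{a, b, u} Φ I} {Λ : Logic Φ I}
  {X : Set (PointedModel.{a, b, u} Φ I)} {f : ModalSpace X → ModalSpace X}

theorem designated_unique (hf : A.IsCleanMap Λ X f) {x : PointedModel.{a, b, u} Φ I} (hx : x ∈ X)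
    {σ τ : A.Action} (hσ : σ ∈ A.designated) (hτ : τ ∈ A.designated)
    (hxσ : x.toKripkeModel.Sat x.point (A.pre σ)) (hxτ : x.toKripkeModel.Sat x.point (A.pre τ)) :
    σ = τ := by
  by_contra hne
  have := hf.deterministic σ hσ τ hτ hne x hx
  simp [PointedModel.Sat, hxσ, hxτ] at this

/-- Truth of a formula after a finite static update is expressible before it. -/
theorem exists_sat_map_iff (hf : A.IsCleanMap Λ X f) (hfin : A.IsFinite) (hstat : A.IsStatic)
    (φ : Formula Φ I) : ∃ ψ : Formula Φ I, ∀ x, (f x).Sat φ ↔ x.Sat ψ := by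
  have : Finite A.Action := hfin
  refine ⟨.bigAnd fun σ : A.designated => .imp (A.pre σ) (A.reduction φ σ), fun x => ?_⟩
  obtain ⟨x, hx, rfl⟩ := x.exists_mk
  have happ := hf.exhaustive x hx
  rw [hf.map_mk, ModalSpace.sat_mk, ModalSpace.sat_mk, sat_reduction hstat,
    KripkeModel.sat_bigAnd]
  simp only [KripkeModel.sat_imp]
  constructor
  · intro H σ hσ
    rwa [hf.designated_unique hx σ.2 happ.choose_spec.1 hσ happ.choose_spec.2]
  · intro H
    exact H ⟨_, happ.choose_spec.1⟩ happ.choose_spec.2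

/-- The states of the iterated updates project to multisets of actions, and their points to
multisets all of whose members are the same action. -/
theorem exists_iterate_eq_mk (hf : A.IsCleanMap Λ X f) (hbool : A.IsBoolean) (hstat : A.IsStatic)
    {x : PointedModel.{a, b, u} Φ I} (hx : x ∈ X) (n : ℕ) :
    ∃ (z : PointedModel.{a, b, u} Φ I) (hz : z ∈ X) (π : z.State → x.State)
      (ρ : z.State → Multiset A.Action), f^[n] (.mk x hx) = .mk z hz ∧
      IsMultiProj A x.toKripkeModel z.toKripkeModel π ρ ∧ π z.point = x.point ∧
      ρ z.point = Multiset.replicate n (hf.exhaustive x hx).choose := by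
  induction n with
  | zero => exact ⟨x, hx, id, fun _ => 0, rfl, .refl, rfl, rfl⟩
  | succ n ih =>
    obtain ⟨z, hz, π, ρ, hfz, hproj, hπ, hρ⟩ := ih
    have happ := hf.exhaustive z hz
    refine ⟨A.update z happ, hf.closing z hz happ, _, _, ?_, hproj.update hbool hstat happ, hπ, ?_⟩
    · rw [Function.iterate_succ_apply', hfz, hf.map_mk]
    -- The precondition chosen at `z` is Boolean, hence true at `x` as well, and determinism
    -- identifies the two designated actions.
    · have hpre := (hproj.sat_iff_of_isBoolean (hbool _) _).1 happ.choose_spec.2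
      rw [hπ] at hpre
      have := hf.designated_unique hx happ.choose_spec.1 (hf.exhaustive x hx).choose_spec.1 hpre
        (hf.exhaustive x hx).choose_spec.2
      change happ.choose ::ₘ ρ z.point = _
      rw [hρ, this, Multiset.replicate_succ]

theorem sat_iterate_eventually_const (hf : A.IsCleanMap Λ X f) (hfin : A.IsFinite)
    (hbool : A.IsBoolean) (hstat : A.IsStatic) (x : ModalSpace X) (φ : Formula Φ I) :
    ∃ N, ∀ n ≥ N, ((f^[n] x).Sat φ ↔ (f^[N] x).Sat φ) := by
  classical
  obtain ⟨x, hx, rfl⟩ := x.exists_mk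
  have hsat : ∀ n, (f^[n] (.mk x hx)).Sat φ ↔ A.MultiSat x.toKripkeModel φ x.point
      (Multiset.replicate n (hf.exhaustive x hx).choose) := fun n => by
    obtain ⟨z, hz, π, ρ, hfz, hproj, hπ, hρ⟩ := hf.exists_iterate_eq_mk hbool hstat hx n
    rw [hfz, ModalSpace.sat_mk, hproj.sat_iff, hπ, hρ]
  obtain ⟨N, hN⟩ := A.exists_multiSat_cons_iff x.toKripkeModel hfin φ
  refine ⟨N, fun n hn => ?_⟩
  simp only [hsat]
  induction n, hn using Nat.le_induction with
  | base => rfl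
  | succ n hn ih =>
    rw [← ih, Multiset.replicate_succ]
    exact (hN _ _ _ (by simpa using hn)).symm

end IsCleanMap

end ActionModel

end DEL

theorem mainTheorem10 {Φ : Type a} {I : Type b} [Countable Φ] [Finite I]
    (Λ : DEL.Logic Φ I) (hΛ : Λ.IsCompact)
    (X : Set (DEL.PointedModel.{a, b, u} Φ I)) (hX : Λ.SoundFor X) (hsat : DEL.IsSaturated Λ X)
    (d : DEL.ModalSpace X → DEL.ModalSpace X → ℝ) (hd : d ∈ DEL.modalMetrics Λ X)
    (f : DEL.ModalSpace X → DEL.ModalSpace X)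
    (A : DEL.ActionModel.{a, b, u} Φ I) (hf : A.IsCleanMap Λ X f)
    (hfinite : A.IsFinite) (hboolean : A.IsBoolean) (hstatic : A.IsStatic)
    (x : DEL.ModalSpace X) :
    ∃ y : DEL.ModalSpace X, f y = y ∧ DEL.ConvergesTo d (fun n => f^[n] x) y ∧
      DEL.limitSet d f x = {y} := by
  obtain ⟨y, hy⟩ := DEL.ModalSpace.exists_limit hX hsat
    (hf.sat_iterate_eventually_const hfinite hboolean hstatic x)
  have hconv := DEL.convergesTo_of_eventually_sat hX hd hy
  refine ⟨y, DEL.ModalSpace.ext_sat fun φ => ?_, hconv, Set.eq_singleton_iff_unique_mem.2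
    ⟨⟨id, strictMono_id, hconv⟩, ?_⟩⟩
  · obtain ⟨ψ, hψ⟩ := hf.exists_sat_map_iff hfinite hstatic φ
    -- A late `n` at which `f^[n] x` agrees with `y` on `ψ` and `f^[n+1] x` agrees with `y` on `φ`.
    obtain ⟨n, h₁, h₂⟩ :=
      ((hy ψ).and ((Filter.tendsto_add_atTop_nat 1).eventually (hy φ))).exists
    rw [hψ, ← h₁, ← h₂, ← hψ, Function.iterate_succ_apply']
  · rintro z ⟨n, hn, hz⟩
    exact DEL.eq_of_convergesTo hX hd (hconv.comp hn.tendsto_atTop) hz
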